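/- Let $d \ge 0$ and let $P \subset \mathbb{R}^d$ be a full-dimensional convex polytope, i.e. the convex hull of finitely many points with $\operatorname{aff}(P) = \mathbb{R}^d$. Its vertices are its $0$-dimensional faces and its facets are its $(d-1)$-dimensional faces (where $\emptyset$ is a face of dimension $-1$). A \emph{vertex-facet assignment} of $P$ is a set of pairs $(v,F)$, where $v$ is a vertex and $F$ is a facet of $P$ with $v \notin F$, such that no vertex and no facet occurs in more than one pair, and such that every vertex occurs in a pair or every facet occurs in a pair (or both). Call $P$ \emph{simplicial} if every facet of $P$ is a simplex, and \emph{simple} if every vertex of $P$ is contained in exactly $d$ facets of $P$. If $P$ is simple or simplicial, then $P$ has a vertex-facet assignment. -/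

import Mathlib

noncomputable section

namespace VertexFacet

/-- The Euclidean space `ℝ^d`. -/
abbrev E (d : ℕ) : Type := EuclideanSpace ℝ (Fin d)

/-- A convex polytope: the convex hull of finitely many points. -/
def IsPolytope {d : ℕ} (P : Set (E d)) : Prop :=
  ∃ s : Finset (E d), P = convexHull ℝ (s : Set (E d))

open Classical in
/-- The dimension of a polytope: the dimension of its affine hull, with `dim ∅ = -1`. -/
def polyDim {d : ℕ} (S : Set (E d)) : ℤ :=
  if S = ∅ then -1 else (Module.finrank ℝ (vectorSpan ℝ S) : ℤ)

/-- The faces of `P`: the empty face and all sets of maximizers over `P` of a linear functional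
(the zero functional gives `P` itself). -/
def faces {d : ℕ} (P : Set (E d)) : Set (Set (E d)) :=
  {σ | IsExposed ℝ P σ}

/-- The faces of `P` of dimension `δ`. -/
def facesOfDim {d : ℕ} (P : Set (E d)) (δ : ℤ) : Set (Set (E d)) :=
  {σ ∈ faces P | polyDim σ = δ}

/-- The vertices of `P`: its faces of dimension `0`. -/
def vertices {d : ℕ} (P : Set (E d)) : Set (Set (E d)) :=
  facesOfDim P 0

/-- The facets of `P`: its faces of dimension `dim P - 1`. -/
def facets {d : ℕ} (P : Set (E d)) : Set (Set (E d)) :=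
  facesOfDim P (polyDim P - 1)

/-- A simplex: the convex hull of finitely many affinely independent points. -/
def IsSimplex {d : ℕ} (S : Set (E d)) : Prop :=
  ∃ s : Finset (E d),
    AffineIndependent ℝ ((↑) : s → E d) ∧ S = convexHull ℝ (s : Set (E d))

/-- A polytope is simplicial if all its facets are simplices. -/
def IsSimplicial {d : ℕ} (P : Set (E d)) : Prop :=
  ∀ F ∈ facets P, IsSimplex F

/-- A polytope is simple if each of its vertices lies in exactly `dim P` facets. -/
def IsSimple {d : ℕ} (P : Set (E d)) : Prop :=
  ∀ v ∈ vertices P, (({F ∈ facets P | v ⊆ F}.ncard : ℕ) : ℤ) = polyDim P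

/-- The vertex-facet graph of `P`: the bipartite graph on (disjoint copies of) the vertices and the
facets of `P`, in which a vertex and a facet are adjacent iff they are non-incident in `P`. -/
def vertexFacetGraph {d : ℕ} (P : Set (E d)) : SimpleGraph (vertices P ⊕ facets P) where
  Adj
    | .inl v, .inr F => ¬ (v : Set (E d)) ⊆ F
    | .inr F, .inl v => ¬ (v : Set (E d)) ⊆ F
    | .inl _, .inl _ => False
    | .inr _, .inr _ => False
  symm := ⟨by rintro (a | a) (b | b) h <;> exact h⟩
  loopless := ⟨by rintro (a | a) h <;> exact h⟩

/-- `P` has a vertex-facet assignment: a matching of the vertex-facet graph that covers all vertices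
or all facets (or both). -/
def HasVertexFacetAssignment {d : ℕ} (P : Set (E d)) : Prop :=
  ∃ M : (vertexFacetGraph P).Subgraph, M.IsMatching ∧
    ((∀ v : vertices P, Sum.inl v ∈ M.verts) ∨ (∀ F : facets P, Sum.inr F ∈ M.verts))

end VertexFacet

end

/-!
Both cases are an application of Hall's marriage theorem: in the simplicial case the vertices are
matched into the facets, in the simple case the facets into the vertices. Below, `d ≠ 0`; a polytope
of dimension `0` is a point, with the empty set as its only facet.

The geometric input is that `P` is cut out by inequalities `a F x ≤ b F`, one for each facet `F` and
tight on `P` exactly along `F` (`IsPolytope.exists_facet_inequalities`). This is obtained from the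
polar body of `P`: a point outside `P` is strictly separated from `P` by an extreme point of the
polar body, and the constraints active at this extreme point span the space, so that it defines a
facet. In the same way, the functionals of the facets through a vertex separate points
(`IsPolytope.injective_pi_facets_through`); hence every vertex lies in at least `d` facets. Dually, a
facet contains at least `d` vertices for reasons of dimension.

*Simplicial case.* Let `A` be a set of vertices. If `A` lies in a facet, then `A` is affinely
independent. As `P` is bounded and not a point, the slack vectors `(b F - a F x)_F` of the points
`x ∈ A` are then linearly independent; they are supported on the facets not containing `A`, so there
are at least `|A|` of these. If `A` lies in no facet, all facets are available, and
there are at least as many facets as vertices by double counting: a facet has at most `d` vertices,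
and a vertex lies in at least `d` facets.

*Simple case.* Let `A` be a set of facets. If the members of `A` share a vertex `v`, then the `d`
functionals of the facets through `v` are linearly independent, so those belonging to `A` map the
space onto `ℝ ^ A`. The vertices in `⋂ A` have the same image as `v`, so the others
must number at least `|A|` for the image to be everything. If the members of `A` share no vertex,
all vertices are available, and there are at least as many vertices as facets, again by double
counting.
-/

namespace VertexFacet

open Set Module Filter Topology

variable {d : ℕ} {P : Set (E d)}

/-! ### Vertices, faces and facets -/

theorem IsPolytope.convex (hP : IsPolytope P) : Convex ℝ P := by
  obtain ⟨s, rfl⟩ := hP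
  exact convex_convexHull ℝ _

theorem IsPolytope.isCompact (hP : IsPolytope P) : IsCompact P := by
  obtain ⟨s, rfl⟩ := hP
  exact s.finite_toSet.isCompact_convexHull (𝕜 := ℝ)

theorem IsPolytope.finite_extremePoints (hP : IsPolytope P) : (P.extremePoints ℝ).Finite := by
  obtain ⟨s, rfl⟩ := hP
  exact s.finite_toSet.subset extremePoints_convexHull_subset

/-- A face is spanned by the extreme points of the polytope on it. This is the Krein–Milman theorem,
as the extreme points of a face are those of the polytope; by finiteness no closure is needed. -/
theorem IsPolytope.eq_convexHull_of_isExposed (hP : IsPolytope P) {F : Set (E d)}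
    (hF : IsExposed ℝ P F) : F = convexHull ℝ (P.extremePoints ℝ ∩ F) := by
  have hc : Convex ℝ F := hF.convex hP.convex
  have hk : IsCompact F := hF.isCompact hP.isCompact
  have hfin : (P.extremePoints ℝ ∩ F).Finite := hP.finite_extremePoints.inter_of_left F
  conv_lhs => rw [← closure_convexHull_extremePoints hk hc, hF.isExtreme.extremePoints_eq,
    inter_comm]
  exact (hfin.isCompact_convexHull (𝕜 := ℝ)).isClosed.closure_eq

theorem IsPolytope.eq_convexHull (hP : IsPolytope P) : P = convexHull ℝ (P.extremePoints ℝ) := by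
  have h := hP.eq_convexHull_of_isExposed (IsExposed.refl P)
  rwa [inter_eq_left.2 extremePoints_subset] at h

theorem IsPolytope.finite_facets (hP : IsPolytope P) : (facets P).Finite := by
  refine Finite.of_injOn (f := fun F => P.extremePoints ℝ ∩ F)
    (t := 𝒫 (P.extremePoints ℝ)) (fun F _ => inter_subset_left) ?_
    hP.finite_extremePoints.finite_subsets
  intro F hF G hG h
  rw [hP.eq_convexHull_of_isExposed hF.1, hP.eq_convexHull_of_isExposed hG.1]
  exact congrArg _ h

/-- Every extreme point of a polytope is exposed: it can be strictly separated from the convex hull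
of the other, finitely many, extreme points. -/
theorem IsPolytope.isExposed_singleton (hP : IsPolytope P) {x : E d}
    (hx : x ∈ P.extremePoints ℝ) : IsExposed ℝ P {x} := by
  intro _
  set T := P.extremePoints ℝ \ {x} with hT
  have hxT : x ∉ convexHull ℝ T := fun h =>
    (hP.convex.mem_extremePoints_iff_mem_sdiff_convexHull_sdiff.1 hx).2
      (convexHull_mono (sdiff_subset_sdiff_left extremePoints_subset) h)
  have hTf : T.Finite := hP.finite_extremePoints.sdiff
  obtain ⟨l, c, hl, hc⟩ := geometric_hahn_banach_closed_point (convex_convexHull ℝ T)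
    (hTf.isCompact_convexHull (𝕜 := ℝ)).isClosed hxT
  have hle : ∀ y ∈ P, l y ≤ l x := by
    have : P ⊆ {y | l y ≤ l x} := by
      conv_lhs => rw [hP.eq_convexHull]
      refine convexHull_min (fun y hy => ?_) (convex_halfSpace_le l.toLinearMap.isLinear _)
      by_cases hyx : y = x
      · simp [hyx]
      · exact ((hl y (subset_convexHull ℝ T ⟨hy, hyx⟩)).trans hc).le
    exact this
  refine ⟨l, ?_⟩
  have hexp : IsExposed ℝ P {y ∈ P | ∀ z ∈ P, l z ≤ l y} := fun _ => ⟨l, rfl⟩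
  rw [hP.eq_convexHull_of_isExposed hexp]
  have : P.extremePoints ℝ ∩ {y ∈ P | ∀ z ∈ P, l z ≤ l y} = {x} := by
    ext y
    constructor
    · rintro ⟨hy, -, hmax⟩
      by_contra hyx
      have h1 := hl y (subset_convexHull ℝ T ⟨hy, hyx⟩)
      have h2 := hmax x hx.1
      linarith
    · rintro rfl
      exact ⟨hx, hx.1, hle⟩
  rw [this, convexHull_singleton]

theorem IsPolytope.vertices_eq (hP : IsPolytope P) :
    vertices P = singleton '' P.extremePoints ℝ := by
  ext σ
  constructor
  · rintro ⟨hσ, hdim⟩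
    unfold polyDim at hdim
    split_ifs at hdim with h0
    obtain ⟨x, hx⟩ := nonempty_iff_ne_empty.2 h0
    have hz : vectorSpan ℝ σ = ⊥ := Submodule.finrank_eq_zero.1 (by exact_mod_cast hdim)
    have hs : σ.Subsingleton := (vectorSpan_eq_bot_iff_subsingleton ℝ).1 hz
    have hsx : σ = {x} := hs.eq_singleton_of_mem hx
    subst hsx
    exact ⟨x, isExtreme_singleton.1 (IsExposed.isExtreme hσ), rfl⟩
  · rintro ⟨x, hx, rfl⟩
    exact ⟨hP.isExposed_singleton hx, by simp [polyDim]⟩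

theorem nonempty_of_affineSpan_eq_top (hfull : affineSpan ℝ P = ⊤) : P.Nonempty := by
  rw [← affineSpan_nonempty ℝ, hfull]
  exact ⟨0, trivial⟩

theorem polyDim_eq (hfull : affineSpan ℝ P = ⊤) : polyDim P = d := by
  have hne := nonempty_of_affineSpan_eq_top hfull
  rw [polyDim, if_neg hne.ne_empty, ← direction_affineSpan, hfull, AffineSubspace.direction_top,
    finrank_top, finrank_euclideanSpace_fin]

theorem mem_facets_iff (hd : d ≠ 0) (hfull : affineSpan ℝ P = ⊤) {F : Set (E d)} :
    F ∈ facets P ↔ IsExposed ℝ P F ∧ F.Nonempty ∧ finrank ℝ (vectorSpan ℝ F) + 1 = d := by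
  rw [facets, polyDim_eq hfull]
  refine and_congr_right fun _ => ?_
  rw [polyDim]
  split_ifs with h
  · subst h
    simp only [Set.not_nonempty_empty, false_and, iff_false]
    omega
  · rw [and_iff_right (nonempty_iff_ne_empty.2 h)]
    omega

/-! ### Facet inequalities -/

/-- An extreme point of a polyhedron cannot be moved along a line that stays in all the
bounding hyperplanes through it. -/
theorem eq_zero_of_mem_extremePoints_polyhedron {V ι : Type*} [AddCommGroup V] [Module ℝ V]
    [Finite ι] (a : ι → V →ₗ[ℝ] ℝ) (b : ι → ℝ) {v : V}
    (hv : v ∈ {x | ∀ i, a i x ≤ b i}.extremePoints ℝ) (w : V)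
    (hw : ∀ i, a i v = b i → a i w = 0) : w = 0 := by
  have key : ∀ᶠ t : ℝ in 𝓝 0, ∀ i, a i v + t * a i w ≤ b i := by
    rw [eventually_all]
    intro i
    rcases (hv.1 i).eq_or_lt with h | h
    · exact Eventually.of_forall fun t => by rw [hw i h]; simp [h]
    · have hcont : Tendsto (fun t : ℝ => a i v + t * a i w) (𝓝 0) (𝓝 (a i v + 0 * a i w)) :=
        Continuous.tendsto (by fun_prop) 0
      rw [zero_mul, add_zero] at hcont
      exact (hcont.eventually_lt_const h).mono fun _ => le_of_lt
  have key' : ∀ᶠ t : ℝ in 𝓝 0, ∀ i, a i v + -t * a i w ≤ b i :=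
    (continuous_neg.tendsto' (0 : ℝ) 0 neg_zero).eventually key
  obtain ⟨t, ⟨h1, h2⟩, ht⟩ := ((key.and key').filter_mono nhdsWithin_le_nhds).and
    (self_mem_nhdsWithin (a := (0 : ℝ)) (s := Ioi 0)) |>.exists
  have ht : 0 < t := ht
  have hmem : v ∈ openSegment ℝ (v + t • w) (v + (-t) • w) :=
    ⟨1 / 2, 1 / 2, by norm_num, by norm_num, by norm_num, by module⟩
  have := hv.2 (x₁ := v + t • w) (x₂ := v + (-t) • w) (fun i => by simpa using h1 i)
    (fun i => by simpa using h2 i) hmem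
  simpa [ht.ne'] using this

/-- A point outside a full-dimensional polytope violates the inequality of some facet. The facet
comes from an extreme point of the polar body, taken among the maximizers of the point: the
constraints active there span the whole space. -/
theorem IsPolytope.exists_facet_of_notMem (hd : d ≠ 0) (hP : IsPolytope P)
    (hfull : affineSpan ℝ P = ⊤) {x : E d} (hx : x ∉ P) :
    ∃ F ∈ facets P, ∃ (l : StrongDual ℝ (E d)) (c : ℝ),
      (∀ y ∈ P, l y ≤ c) ∧ F = {y ∈ P | l y = c} ∧ c < l x := by
  have hconv := hP.convex
  have hcpt := hP.isCompact
  obtain ⟨p, hp⟩ := hconv.interior_nonempty_iff_affineSpan_eq_top.2 hfull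
  obtain ⟨s, hs⟩ := id hP
  have hsP : ∀ y ∈ s, y ∈ P := fun y hy => hs ▸ subset_convexHull ℝ _ hy
  have hsub : ∀ (l : StrongDual ℝ (E d)) (c : ℝ), (∀ y ∈ s, l y ≤ c) → ∀ y ∈ P, l y ≤ c := by
    intro l c h y hy
    rw [hs] at hy
    exact convexHull_min (t := {y | l y ≤ c}) (fun y hy => h y hy)
      (convex_halfSpace_le l.toLinearMap.isLinear _) hy
  -- the polar body of `P` with respect to the interior point `p`
  set Q : Set (E d) := {u | ∀ y : s, innerₗ (E d) (y - p) u ≤ 1} with hQ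
  have hQmem : ∀ u, u ∈ Q ↔ ∀ y ∈ s, inner ℝ u (y - p) ≤ 1 := by
    refine fun u => ⟨fun h y hy => ?_, fun h y => ?_⟩
    · rw [real_inner_comm]; exact h ⟨y, hy⟩
    · rw [innerₗ_apply_apply, real_inner_comm]; exact h y y.2
  have hQP : ∀ u ∈ Q, ∀ y ∈ P, inner ℝ u y ≤ 1 + inner ℝ u p := by
    intro u hu
    refine hsub (innerSL ℝ u) _ fun y hy => ?_
    have := (hQmem u).1 hu y hy
    rw [inner_sub_right] at this
    simp only [innerSL_apply_apply]
    linarith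
  have hQclosed : IsClosed Q := by
    have : Q = ⋂ y ∈ s, {u | inner ℝ u (y - p) ≤ 1} := by
      ext u; simp [hQmem]
    rw [this]
    exact isClosed_biInter fun y _ => isClosed_le (by fun_prop) continuous_const
  have hQbdd : Bornology.IsBounded Q := by
    obtain ⟨ε, hε, hball⟩ := Metric.mem_nhds_iff.1 (mem_interior_iff_mem_nhds.1 hp)
    refine (Metric.isBounded_closedBall (x := (0 : E d)) (r := 2 / ε)).subset fun u hu => ?_
    rw [mem_closedBall_zero_iff]
    by_cases hu0 : u = 0
    · subst hu0; simp; positivity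
    have hun : 0 < ‖u‖ := norm_pos_iff.2 hu0
    have hmem : p + (ε / 2 / ‖u‖) • u ∈ P := by
      apply hball
      rw [mem_ball_iff_norm, add_sub_cancel_left, norm_smul, Real.norm_of_nonneg (by positivity),
        div_mul_cancel₀ _ hun.ne']
      linarith
    have h := hQP u hu _ hmem
    rw [inner_add_right, inner_smul_right, real_inner_self_eq_norm_sq] at h
    have h' : ε / 2 / ‖u‖ * ‖u‖ ^ 2 = ε / 2 * ‖u‖ := by field_simp
    rw [h'] at h
    rw [le_div_iff₀ hε]
    linarith
  have hQcpt : IsCompact Q := Metric.isCompact_of_isClosed_isBounded hQclosed hQbdd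
  -- a separating functional, rescaled, gives a point of the polar body
  obtain ⟨u₁, hu₁Q, hu₁⟩ : ∃ u ∈ Q, 1 < inner ℝ u (x - p) := by
    obtain ⟨f, c, hfc, hfx⟩ := geometric_hahn_banach_closed_point hconv hcpt.isClosed hx
    have hpos : 0 < c - f p := sub_pos.2 (hfc p (interior_subset hp))
    refine ⟨(c - f p)⁻¹ • (InnerProductSpace.toDual ℝ (E d)).symm f, (hQmem _).2 fun y hy => ?_, ?_⟩
    · rw [inner_smul_left, InnerProductSpace.toDual_symm_apply, map_sub]
      have := hfc y (hsP y hy)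
      simp only [conj_trivial]
      rw [inv_mul_le_iff₀ hpos]
      linarith
    · rw [inner_smul_left, InnerProductSpace.toDual_symm_apply, map_sub]
      simp only [conj_trivial]
      rw [lt_inv_mul_iff₀ hpos]
      linarith
  obtain ⟨u, huQ, hu⟩ : ∃ u ∈ Q.extremePoints ℝ, 1 < inner ℝ u (x - p) := by
    set l : StrongDual ℝ (E d) := innerSL ℝ (x - p)
    have hexp : IsExposed ℝ Q (l.toExposed Q) := ContinuousLinearMap.toExposed.isExposed
    obtain ⟨m, hmQ, hm⟩ := hQcpt.exists_isMaxOn ⟨u₁, hu₁Q⟩ l.continuous.continuousOn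
    obtain ⟨u, hu⟩ := (hexp.isCompact hQcpt).extremePoints_nonempty ⟨m, hmQ, hm⟩
    refine ⟨u, hexp.isExtreme.extremePoints_subset_extremePoints hu, hu₁.trans_le ?_⟩
    have := hu.1.2 u₁ hu₁Q
    simpa only [l, innerSL_apply_apply, real_inner_comm] using this
  have hspan : ∀ w : E d, (∀ y ∈ s, inner ℝ u (y - p) = 1 → inner ℝ w (y - p) = 0) → w = 0 := by
    intro w hw
    refine eq_zero_of_mem_extremePoints_polyhedron _ _ huQ w fun y hy => ?_
    rw [innerₗ_apply_apply, real_inner_comm] at hy ⊢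
    exact hw y y.2 hy
  have hnt : Nontrivial (E d) :=
    nontrivial_of_finrank_pos (R := ℝ) (by rw [finrank_euclideanSpace_fin]; omega)
  obtain ⟨t, hts, ht⟩ : ∃ t ∈ s, inner ℝ u (t - p) = 1 := by
    by_contra! h
    obtain ⟨w, hw⟩ := exists_ne (0 : E d)
    exact hw (hspan w fun y hy h1 => (h y hy h1).elim)
  have hle := hQP u huQ.1
  have heq : ∀ y, inner ℝ u (y - p) = 1 ↔ inner ℝ u y = 1 + inner ℝ u p := by
    intro y; rw [inner_sub_right]; constructor <;> intro h <;> linarith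
  set F : Set (E d) := {y ∈ P | innerSL ℝ u y = 1 + inner ℝ u p} with hF
  have htF : t ∈ F := ⟨hsP t hts, by simpa using (heq t).1 ht⟩
  refine ⟨F, (mem_facets_iff hd hfull).2 ⟨fun _ => ⟨innerSL ℝ u, ?_⟩, ⟨t, htF⟩, ?_⟩,
    innerSL ℝ u, 1 + inner ℝ u p, hle, rfl, ?_⟩
  · ext y
    constructor
    · rintro ⟨hy, h⟩
      exact ⟨hy, fun z hz => h ▸ hle z hz⟩
    · rintro ⟨hy, h⟩
      exact ⟨hy, le_antisymm (hle y hy) (htF.2 ▸ h t htF.1)⟩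
  · have hu0 : u ≠ 0 := by rintro rfl; simp at ht
    have h1 : vectorSpan ℝ F ≤ (Submodule.span ℝ {u})ᗮ := by
      rw [vectorSpan_def, Submodule.span_le]
      rintro _ ⟨y, hy, z, hz, rfl⟩
      rw [SetLike.mem_coe, Submodule.mem_orthogonal_singleton_iff_inner_right]
      have hy2 := hy.2
      have hz2 := hz.2
      simp only [innerSL_apply_apply] at hy2 hz2
      simp [inner_sub_right, hy2, hz2]
    have h2 : vectorSpan ℝ F ⊔ Submodule.span ℝ {t - p} = ⊤ := by
      rw [← Submodule.orthogonal_eq_bot_iff, eq_bot_iff]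
      intro w hw
      rw [← Submodule.inf_orthogonal, Submodule.mem_inf,
        Submodule.mem_orthogonal_singleton_iff_inner_left] at hw
      refine hspan w fun y hys hy => ?_
      have hyF : y ∈ F := ⟨hsP y hys, by simpa using (heq y).1 hy⟩
      have := (Submodule.mem_orthogonal' _ _).1 hw.1 _ (vsub_mem_vectorSpan ℝ hyF htF)
      rw [vsub_eq_sub, ← sub_sub_sub_cancel_right y t p, inner_sub_right, hw.2, sub_zero] at this
      exact this
    have h3 := Submodule.finrank_mono h1
    have h4 := Submodule.finrank_add_finrank_orthogonal (Submodule.span ℝ {u})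
    rw [finrank_span_singleton hu0, finrank_euclideanSpace_fin] at h4
    have h5 := Submodule.finrank_add_le_finrank_add_finrank (vectorSpan ℝ F)
      (Submodule.span ℝ {t - p})
    have h6 := finrank_span_le_card (R := ℝ) ({t - p} : Set (E d))
    rw [h2, finrank_top, finrank_euclideanSpace_fin] at h5
    rw [toFinset_singleton, Finset.card_singleton] at h6
    omega
  · rw [inner_sub_right] at hu
    simp only [innerSL_apply_apply]
    linarith

/-- A full-dimensional polytope is cut out by one inequality for each of its facets, tight exactly
on that facet. -/
theorem IsPolytope.exists_facet_inequalities (hd : d ≠ 0) (hP : IsPolytope P)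
    (hfull : affineSpan ℝ P = ⊤) :
    ∃ (a : Set (E d) → StrongDual ℝ (E d)) (b : Set (E d) → ℝ),
      (∀ F ∈ facets P, F = {x ∈ P | a F x = b F}) ∧ P = {x | ∀ F : facets P, a F x ≤ b F} := by
  have hex : ∀ F ∈ facets P, ∃ (a : StrongDual ℝ (E d)) (b : ℝ),
      F = {x ∈ P | a x = b} ∧ ∀ x ∈ P, a x ≤ b := by
    intro F hF
    obtain ⟨hexp, ⟨y, hy⟩, -⟩ := (mem_facets_iff hd hfull).1 hF
    obtain ⟨a, ha⟩ := hexp ⟨y, hy⟩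
    rw [ha] at hy
    refine ⟨a, a y, ?_, hy.2⟩
    rw [ha]
    ext z
    exact ⟨fun hz => ⟨hz.1, le_antisymm (hy.2 z hz.1) (hz.2 y hy.1)⟩,
      fun hz => ⟨hz.1, fun w hw => hz.2 ▸ hy.2 w hw⟩⟩
  choose! a b hab hle using hex
  refine ⟨a, b, hab, Subset.antisymm (fun x hx F => hle F F.2 x hx) fun x hx => ?_⟩
  by_contra hxP
  obtain ⟨F, hF, l, c, hlc, hFl, hlx⟩ := hP.exists_facet_of_notMem hd hfull hxP
  obtain ⟨-, ⟨y, hy⟩, hdim⟩ := (mem_facets_iff hd hfull).1 hF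
  have hya : a F y = b F := by rw [hab F hF] at hy; exact hy.2
  have hyl : l y = c := by rw [hFl] at hy; exact hy.2
  -- some point of `P` lies off the facet
  obtain ⟨z, hz, hzF⟩ : ∃ z ∈ P, z ∉ F := by
    by_contra! h
    have hPF : P = F := Subset.antisymm h (hFl ▸ sep_subset _ _)
    rw [← hPF, ← direction_affineSpan, hfull, AffineSubspace.direction_top, finrank_top,
      finrank_euclideanSpace_fin] at hdim
    omega
  have hza : a F z < b F := (hle F hF z hz).lt_of_ne fun h => hzF (by rw [hab F hF]; exact ⟨hz, h⟩)
  have hzl : l z < c := (hlc z hz).lt_of_ne fun h => hzF (by rw [hFl]; exact ⟨hz, h⟩)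
  -- both functionals have the direction of `F` as kernel, so they are proportional
  have hker : LinearMap.ker l.toLinearMap ≤ LinearMap.ker (a F).toLinearMap := by
    have h1 : vectorSpan ℝ F ≤ LinearMap.ker l.toLinearMap := by
      rw [vectorSpan_def, Submodule.span_le]
      rintro _ ⟨v, hv, w, hw, rfl⟩
      rw [hFl] at hv hw
      simp [hv.2, hw.2]
    have h2 : vectorSpan ℝ F ≤ LinearMap.ker (a F).toLinearMap := by
      rw [vectorSpan_def, Submodule.span_le]
      rintro _ ⟨v, hv, w, hw, rfl⟩
      rw [hab F hF] at hv hw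
      simp [hv.2, hw.2]
    have h3 : LinearMap.ker l.toLinearMap ≠ ⊤ := by
      intro h
      have hl0 : l.toLinearMap = 0 := LinearMap.ker_eq_top.1 h
      have h4 : l z = 0 := LinearMap.congr_fun hl0 z
      have h5 : l y = 0 := LinearMap.congr_fun hl0 y
      linarith
    have h4 := Submodule.finrank_lt h3
    rw [finrank_euclideanSpace_fin] at h4
    rwa [← Submodule.eq_of_le_of_finrank_le h1 (by omega)]
  obtain ⟨r, hr⟩ : ∃ r : ℝ, r • l.toLinearMap = (a F).toLinearMap := by
    have := mem_span_of_iInf_ker_le_ker (L := fun _ : Unit => l.toLinearMap)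
      (K := (a F).toLinearMap) (by simpa using hker)
    rw [range_const] at this
    exact Submodule.mem_span_singleton.1 this
  have hr' : ∀ w, r * l w = a F w := fun w => LinearMap.congr_fun hr w
  have h1 := hr' x
  have h2 := hr' y
  have h3 := hr' z
  have h4 : a F x ≤ b F := hx ⟨F, hF⟩
  have hrpos : 0 < r := by nlinarith
  nlinarith

/-! ### Counting vertices and facets -/

section FacetInequalities

variable {a : Set (E d) → StrongDual ℝ (E d)} {b : Set (E d) → ℝ}

/-- The recession cone of a polytope is trivial. -/
theorem IsPolytope.eq_zero_of_forall_facets_nonpos (hP : IsPolytope P) (hne : P.Nonempty)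
    (hab : P = {x | ∀ F : facets P, a F x ≤ b F}) {w : E d} (hw : ∀ F : facets P, a F w ≤ 0) :
    w = 0 := by
  obtain ⟨p, hp⟩ := hne
  obtain ⟨C, hC⟩ := hP.isCompact.isBounded.exists_norm_le
  by_contra hw0
  have hwn : 0 < ‖w‖ := norm_pos_iff.2 hw0
  have hC0 : 0 ≤ C := (norm_nonneg p).trans (hC p hp)
  set t : ℝ := (2 * C + 1) / ‖w‖ with ht
  have ht0 : 0 ≤ t := by positivity
  have hmem : p + t • w ∈ P := by
    rw [hab] at hp ⊢
    intro F
    have h1 := hp F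
    have h2 := mul_nonpos_of_nonneg_of_nonpos ht0 (hw F)
    simp only [map_add, map_smul, smul_eq_mul]
    linarith
  have h1 := hC _ hmem
  have h2 := hC p hp
  have h3 : ‖t • w‖ = 2 * C + 1 := by
    rw [norm_smul, Real.norm_of_nonneg ht0, ht, div_mul_cancel₀ _ hwn.ne']
  have h4 := norm_sub_le (p + t • w) p
  rw [add_sub_cancel_left] at h4
  linarith

/-- The functionals of the facets through a vertex separate the points of the space. -/
theorem IsPolytope.injective_pi_facets_through (hP : IsPolytope P)
    (ha : ∀ F ∈ facets P, F = {x ∈ P | a F x = b F})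
    (hab : P = {x | ∀ F : facets P, a F x ≤ b F}) {v : E d} (hv : v ∈ P.extremePoints ℝ) :
    Function.Injective
      (LinearMap.pi fun F : ↥{F ∈ facets P | v ∈ F} => (a F).toLinearMap) := by
  have := hP.finite_facets.to_subtype
  rw [← LinearMap.ker_eq_bot, LinearMap.ker_eq_bot']
  intro w hw
  refine eq_zero_of_mem_extremePoints_polyhedron (fun F : facets P => (a F).toLinearMap)
    (fun F => b F) (v := v) ?_ w fun F hF => congrFun hw ⟨F, F.2, ?_⟩
  · have hab' : {x | ∀ F : facets P, (a F).toLinearMap x ≤ b F} = P := hab.symm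
    rwa [hab']
  · rw [ha F F.2]
    exact ⟨hv.1, hF⟩

end FacetInequalities

/-- The facets missing some point of an affinely independent set `A` are at least as many as the
points of `A`: the slack vectors of these points are linearly independent, and they are supported on
those facets. -/
theorem IsPolytope.ncard_le_ncard_facets_of_affineIndependent (hd : d ≠ 0) (hP : IsPolytope P)
    (hfull : affineSpan ℝ P = ⊤) {A : Set (E d)}
    (hA : AffineIndependent ℝ ((↑) : A → E d)) :
    A.ncard ≤ {F ∈ facets P | ∃ x ∈ A, x ∉ F}.ncard := by
  classical
  obtain ⟨a, b, ha, hab⟩ := hP.exists_facet_inequalities hd hfull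
  have hne := nonempty_of_affineSpan_eq_top hfull
  set N := {F ∈ facets P | ∃ x ∈ A, x ∉ F} with hN
  have hNfin : N.Finite := hP.finite_facets.subset (sep_subset _ _)
  have := hNfin.fintype
  have hAfin : A.Finite := finite_set_of_fin_dim_affineIndependent ℝ hA
  have := hAfin.fintype
  have hli : LinearIndependent ℝ (fun (x : A) (F : N) => b F - a F x) := by
    rw [Fintype.linearIndependent_iff]
    intro c hc
    set σ : ℝ := ∑ x, c x with hσ
    set y : E d := ∑ x, c x • (x : E d) with hy
    -- the relation holds on every facet, as the slacks vanish on the facets containing `A`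
    have hrel : ∀ F : facets P, σ * b F = a F y := by
      intro F
      have hsum : ∑ x : A, c x * (b F - a F x) = 0 := by
        by_cases hF : (F : Set (E d)) ∈ N
        · simpa using congrFun hc ⟨F, hF⟩
        · refine Finset.sum_eq_zero fun x _ => ?_
          have hx : (x : E d) ∈ (F : Set (E d)) := by
            by_contra h
            exact hF ⟨F.2, x, x.2, h⟩
          rw [ha F F.2] at hx
          rw [hx.2, sub_self, mul_zero]
      simp only [mul_sub, Finset.sum_sub_distrib, ← Finset.sum_mul] at hsum
      rw [hy, map_sum]
      simp only [map_smul, smul_eq_mul]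
      linarith
    have hσ0 : σ = 0 := by
      by_contra hσ0
      -- otherwise all facet hyperplanes meet in a point, and `P` would be a cone
      have hall : ∀ z ∈ P, z = σ⁻¹ • y := by
        intro z hz
        refine sub_eq_zero.1 (hP.eq_zero_of_forall_facets_nonpos hne hab fun F => ?_)
        rw [hab] at hz
        have h1 := hz F
        rw [map_sub, map_smul, ← hrel F, smul_eq_mul, inv_mul_cancel_left₀ hσ0]
        linarith
      have hsub : P.Subsingleton := fun z hz w hw => (hall z hz).trans (hall w hw).symm
      have h0 := (vectorSpan_eq_bot_iff_subsingleton ℝ).2 hsub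
      have h1 : finrank ℝ (vectorSpan ℝ P) = d := by
        rw [← direction_affineSpan, hfull, AffineSubspace.direction_top, finrank_top,
          finrank_euclideanSpace_fin]
      rw [h0, finrank_bot] at h1
      exact hd h1.symm
    have hy0 : y = 0 := by
      refine hP.eq_zero_of_forall_facets_nonpos hne hab fun F => ?_
      rw [← hrel F, hσ0, zero_mul]
    intro x
    exact (affineIndependent_iff.1 hA) Finset.univ c hσ0 hy0 x (Finset.mem_univ x)
  have := hli.fintype_card_le_finrank
  rwa [finrank_fintype_fun_eq_card, ← Nat.card_eq_fintype_card, ← Nat.card_eq_fintype_card,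
    Nat.card_coe_set_eq, Nat.card_coe_set_eq] at this

theorem IsPolytope.le_ncard_facets_through (hd : d ≠ 0) (hP : IsPolytope P)
    (hfull : affineSpan ℝ P = ⊤) {v : E d} (hv : v ∈ P.extremePoints ℝ) :
    d ≤ {F ∈ facets P | v ∈ F}.ncard := by
  obtain ⟨a, b, ha, hab⟩ := hP.exists_facet_inequalities hd hfull
  set I := {F ∈ facets P | v ∈ F}
  have := (hP.finite_facets.subset (sep_subset _ _ : I ⊆ _)).fintype
  have hL := hP.injective_pi_facets_through ha hab hv
  have := LinearMap.finrank_le_finrank_of_injective hL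
  rwa [finrank_euclideanSpace_fin, finrank_fintype_fun_eq_card, ← Nat.card_eq_fintype_card,
    Nat.card_coe_set_eq] at this

/-- Let `A` be a set of facets through a vertex `v` that lies in exactly `d` facets. The functionals
of the facets through `v` are then linearly independent, so that those of `A` map the space onto
`ℝ ^ A`. The image is spanned by the vertices off some member of `A`, as the other vertices
go to the image of `v`. -/
theorem IsPolytope.ncard_le_ncard_extremePoints_of_simple_vertex (hd : d ≠ 0) (hP : IsPolytope P)
    (hfull : affineSpan ℝ P = ⊤) {v : E d} (hv : v ∈ P.extremePoints ℝ)
    (hvd : {F ∈ facets P | v ∈ F}.ncard = d) {A : Set (Set (E d))} (hA : A ⊆ facets P)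
    (hvA : ∀ F ∈ A, v ∈ F) :
    A.ncard ≤ {x ∈ P.extremePoints ℝ | ∃ F ∈ A, x ∉ F}.ncard := by
  classical
  obtain ⟨a, b, ha, hab⟩ := hP.exists_facet_inequalities hd hfull
  set I := {F ∈ facets P | v ∈ F}
  have := (hP.finite_facets.subset (sep_subset _ _ : I ⊆ _)).fintype
  have := (hP.finite_facets.subset hA).fintype
  set W := {x ∈ P.extremePoints ℝ | ∃ F ∈ A, x ∉ F} with hW
  have hWfin : W.Finite := hP.finite_extremePoints.subset (sep_subset _ _)
  have hL := hP.injective_pi_facets_through ha hab hv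
  have hLs : Function.Surjective (LinearMap.pi fun F : I => (a F).toLinearMap) := by
    refine (LinearMap.injective_iff_surjective_of_finrank_eq_finrank ?_).1 hL
    rw [finrank_euclideanSpace_fin, finrank_fintype_fun_eq_card, ← Nat.card_eq_fintype_card,
      Nat.card_coe_set_eq, hvd]
  let M : E d →ₗ[ℝ] A → ℝ := LinearMap.pi fun F => (a F).toLinearMap
  have hM : Function.Surjective M := by
    have hAI : A ⊆ I := fun F hF => ⟨hA hF, hvA F hF⟩
    exact (LinearMap.funLeft_surjective_of_injective ℝ ℝ (inclusion hAI)
      (inclusion_injective hAI)).comp hLs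
  have htop : Submodule.span ℝ ((· -ᵥ v) '' P.extremePoints ℝ) = ⊤ := by
    rw [← vectorSpan_eq_span_vsub_set_right ℝ hv, ← direction_affineSpan,
      ← affineSpan_convexHull, ← hP.eq_convexHull, hfull, AffineSubspace.direction_top]
  have hspan : Submodule.span ℝ ((hWfin.toFinset.image fun x => M (x - v) : Finset (A → ℝ)) :
      Set (A → ℝ)) = ⊤ := by
    rw [eq_top_iff, ← LinearMap.range_eq_top.2 hM, LinearMap.range_eq_map, ← htop,
      Submodule.map_span, Submodule.span_le]
    rintro _ ⟨_, ⟨x, hx, rfl⟩, rfl⟩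
    by_cases hxW : x ∈ W
    · refine Submodule.subset_span ?_
      rw [Finset.mem_coe, Finset.mem_image]
      exact ⟨x, hWfin.mem_toFinset.2 hxW, rfl⟩
    · have h0 : M (x -ᵥ v) = 0 := by
        funext F
        have hxF : x ∈ (F : Set (E d)) := by
          by_contra h
          exact hxW ⟨hx, F, F.2, h⟩
        have hvF := hvA F F.2
        rw [ha F (hA F.2)] at hxF hvF
        have : a F (x - v) = 0 := by rw [map_sub, hxF.2, hvF.2, sub_self]
        exact this
      rw [h0]
      exact zero_mem _
  have h1 := finrank_span_finset_le_card (R := ℝ) (hWfin.toFinset.image fun x => M (x - v))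
  rw [Set.finrank, hspan, finrank_top, finrank_fintype_fun_eq_card, ← Nat.card_eq_fintype_card,
    Nat.card_coe_set_eq] at h1
  rw [ncard_eq_toFinset_card W hWfin]
  exact h1.trans Finset.card_image_le

/-- A facet has at least `d` vertices. -/
theorem IsPolytope.le_ncard_extremePoints_inter (hd : d ≠ 0) (hP : IsPolytope P)
    (hfull : affineSpan ℝ P = ⊤) {F : Set (E d)} (hF : F ∈ facets P) :
    d ≤ (P.extremePoints ℝ ∩ F).ncard := by
  obtain ⟨hexp, hne, hdim⟩ := (mem_facets_iff hd hfull).1 hF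
  have hfin : (P.extremePoints ℝ ∩ F).Finite := hP.finite_extremePoints.inter_of_left F
  have := hfin.fintype
  have heq := hP.eq_convexHull_of_isExposed hexp
  have hne' : (P.extremePoints ℝ ∩ F).Nonempty := by
    rw [← convexHull_nonempty_iff (𝕜 := ℝ), ← heq]
    exact hne
  have hpos : 0 < (P.extremePoints ℝ ∩ F).ncard := (ncard_pos hfin).2 hne'
  have h1 := finrank_vectorSpan_range_le ℝ ((↑) : ↥(P.extremePoints ℝ ∩ F) → E d)
    (n := (P.extremePoints ℝ ∩ F).ncard - 1)
    (by rw [← Nat.card_eq_fintype_card, Nat.card_coe_set_eq]; omega)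
  rw [Subtype.range_coe, ← direction_affineSpan, ← affineSpan_convexHull, ← heq,
    direction_affineSpan] at h1
  omega

/-- The vertices on a facet that is a simplex are affinely independent, and there are at most `d` of
them. -/
theorem extremePoints_inter_of_isSimplex (hd : d ≠ 0) (hfull : affineSpan ℝ P = ⊤) {F : Set (E d)}
    (hF : F ∈ facets P) (hs : IsSimplex F) :
    AffineIndependent ℝ ((↑) : ↥(P.extremePoints ℝ ∩ F) → E d) ∧
      (P.extremePoints ℝ ∩ F).ncard ≤ d := by
  obtain ⟨hexp, hne, hdim⟩ := (mem_facets_iff hd hfull).1 hF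
  obtain ⟨s, hsi, rfl⟩ := hs
  have hsub : P.extremePoints ℝ ∩ convexHull ℝ (s : Set (E d)) ⊆ s := by
    rw [inter_comm, ← hexp.isExtreme.extremePoints_eq]
    exact extremePoints_convexHull_subset
  have hsne : Nonempty s := (convexHull_nonempty_iff.1 hne).to_subtype
  refine ⟨hsi.mono hsub, ?_⟩
  have h1 := hsi.finrank_vectorSpan_add_one
  have h2 : vectorSpan ℝ (range ((↑) : s → E d)) = vectorSpan ℝ (convexHull ℝ (s : Set (E d))) := by
    rw [Subtype.range_coe, ← direction_affineSpan, ← affineSpan_convexHull, direction_affineSpan]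
  rw [h2, hdim, Fintype.card_coe] at h1
  exact (ncard_le_ncard hsub s.finite_toSet).trans_eq ((ncard_coe_finset s).trans h1.symm)

/-! ### Matchings from counting -/

/-- A comparison of cardinalities by double counting the pairs related by `r`. -/
theorem ncard_le_ncard_of_forall_incidence {α β : Type*} {X : Set α} {Y : Set β} (hXf : X.Finite)
    (hYf : Y.Finite) (r : α → β → Prop) {k : ℕ} (hk : k ≠ 0)
    (hX : ∀ x ∈ X, k ≤ {y ∈ Y | r x y}.ncard) (hY : ∀ y ∈ Y, {x ∈ X | r x y}.ncard ≤ k) :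
    X.ncard ≤ Y.ncard := by
  classical
  lift X to Finset α using hXf
  lift Y to Finset β using hYf
  rw [ncard_coe_finset, ncard_coe_finset]
  refine Nat.le_of_mul_le_mul_left ?_ (Nat.pos_of_ne_zero hk)
  rw [mul_comm k, mul_comm k]
  refine Finset.card_mul_le_card_mul r (fun x hx => ?_) fun y hy => ?_
  · have := hX x hx
    rwa [← ncard_coe_finset, Finset.coe_bipartiteAbove]
  · have := hY y hy
    rwa [← ncard_coe_finset, Finset.coe_bipartiteBelow]

/-- Hall's marriage theorem for a finite bipartite graph whose colour classes are given as the ranges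
of two maps. -/
theorem exists_isMatching_of_forall_ncard_le_ncard {V α β : Type*} [Finite V] {G : SimpleGraph V}
    {f : α → V} {g : β → V} (hf : Function.Injective f) (hg : Function.Injective g)
    (hG : G.IsBipartiteWith (range f) (range g))
    (h : ∀ s : Set α, s.ncard ≤ {y | ∃ x ∈ s, G.Adj (f x) (g y)}.ncard) :
    ∃ M : G.Subgraph, M.IsMatching ∧ ∀ x, f x ∈ M.verts := by
  let _ : G.LocallyFinite := fun _ => Fintype.ofFinite _
  obtain ⟨M, hM, hM'⟩ := SimpleGraph.exists_isMatching_of_forall_ncard_le hG fun s hs => by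
    obtain ⟨t, rfl⟩ := subset_range_iff_exists_image_eq.1 hs
    rw [ncard_image_of_injective t hf]
    refine (h t).trans ?_
    rw [← ncard_image_of_injective _ hg]
    refine ncard_le_ncard ?_ (toFinite _)
    rintro _ ⟨y, ⟨x, hx, hxy⟩, rfl⟩
    exact mem_biUnion (mem_image_of_mem f hx) hxy
  exact ⟨M, hM', fun x => hM (mem_range_self x)⟩

theorem IsPolytope.finite_vertices (hP : IsPolytope P) : (vertices P).Finite := by
  rw [hP.vertices_eq]
  exact hP.finite_extremePoints.image _

theorem vertexFacetGraph_isBipartiteWith (P : Set (E d)) :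
    (vertexFacetGraph P).IsBipartiteWith (range Sum.inl) (range Sum.inr) where
  disjoint := isCompl_range_inl_range_inr.disjoint
  mem_of_adj := by
    rintro (v | F) (w | G) h
    · exact h.elim
    · exact Or.inl ⟨⟨v, rfl⟩, ⟨G, rfl⟩⟩
    · exact Or.inr ⟨⟨F, rfl⟩, ⟨w, rfl⟩⟩
    · exact h.elim

/-- Hall's condition for the vertices, with a vertex replaced by its only point. -/
theorem IsPolytope.hasVertexFacetAssignment_of_extremePoints (hP : IsPolytope P)
    (h : ∀ A ⊆ P.extremePoints ℝ, A.ncard ≤ {F ∈ facets P | ∃ x ∈ A, x ∉ F}.ncard) :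
    HasVertexFacetAssignment P := by
  have := hP.finite_vertices.to_subtype
  have := hP.finite_facets.to_subtype
  obtain ⟨M, hM, hM'⟩ := exists_isMatching_of_forall_ncard_le_ncard (G := vertexFacetGraph P)
    Sum.inl_injective Sum.inr_injective (vertexFacetGraph_isBipartiteWith P) fun s => by
    set A : Set (E d) := {x | {x} ∈ Subtype.val '' s} with hA
    have hAs : singleton '' A = Subtype.val '' s := by
      refine Subset.antisymm (by rintro _ ⟨x, hx, rfl⟩; exact hx) ?_
      rintro _ ⟨v, hv, rfl⟩
      obtain ⟨x, -, hx⟩ := hP.vertices_eq.subset v.2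
      exact ⟨x, ⟨v, hv, hx.symm⟩, hx⟩
    have hAP : A ⊆ P.extremePoints ℝ := by
      rintro x ⟨v, -, hv⟩
      obtain ⟨y, hy, hyv⟩ := hP.vertices_eq.subset v.2
      rwa [← singleton_injective (hyv.trans hv)]
    rw [← ncard_image_of_injective s Subtype.val_injective, ← hAs,
      ncard_image_of_injective A singleton_injective]
    refine (h A hAP).trans ?_
    rw [← ncard_image_of_injective _ Subtype.val_injective]
    refine ncard_le_ncard ?_ (toFinite _)
    rintro F ⟨hF, x, ⟨v, hvs, hv⟩, hxF⟩
    refine ⟨⟨F, hF⟩, ⟨v, hvs, fun hvF => hxF ?_⟩, rfl⟩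
    exact hvF (hv ▸ mem_singleton x)
  exact ⟨M, hM, Or.inl hM'⟩

/-- Hall's condition for the facets, with a vertex replaced by its only point. -/
theorem IsPolytope.hasVertexFacetAssignment_of_facets (hP : IsPolytope P)
    (h : ∀ A ⊆ facets P, A.ncard ≤ {x ∈ P.extremePoints ℝ | ∃ F ∈ A, x ∉ F}.ncard) :
    HasVertexFacetAssignment P := by
  have := hP.finite_vertices.to_subtype
  have := hP.finite_facets.to_subtype
  obtain ⟨M, hM, hM'⟩ := exists_isMatching_of_forall_ncard_le_ncard (G := vertexFacetGraph P)
    Sum.inr_injective Sum.inl_injective (vertexFacetGraph_isBipartiteWith P).symm fun s => by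
    rw [← ncard_image_of_injective s Subtype.val_injective]
    refine (h _ (Subtype.coe_image_subset _ s)).trans ?_
    rw [← ncard_image_of_injective _ Subtype.val_injective,
      ← ncard_image_of_injective _ (singleton_injective (α := E d))]
    refine ncard_le_ncard ?_ (toFinite _)
    rintro _ ⟨x, ⟨hx, _, ⟨F, hFs, rfl⟩, hxF⟩, rfl⟩
    refine ⟨⟨{x}, hP.vertices_eq.superset ⟨x, hx, rfl⟩⟩, ⟨F, hFs, fun hxF' => hxF ?_⟩, rfl⟩
    exact hxF' (mem_singleton x)
  exact ⟨M, hM, Or.inr hM'⟩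

theorem IsPolytope.hasVertexFacetAssignment_of_isSimplicial (hd : d ≠ 0) (hP : IsPolytope P)
    (hfull : affineSpan ℝ P = ⊤) (hs : IsSimplicial P) : HasVertexFacetAssignment P := by
  refine hP.hasVertexFacetAssignment_of_extremePoints fun A hA => ?_
  by_cases hAF : ∃ F ∈ facets P, A ⊆ F
  · obtain ⟨F, hF, hAF⟩ := hAF
    refine hP.ncard_le_ncard_facets_of_affineIndependent hd hfull ?_
    exact (extremePoints_inter_of_isSimplex hd hfull hF (hs F hF)).1.mono (subset_inter hA hAF)
  · have heq : {F ∈ facets P | ∃ x ∈ A, x ∉ F} = facets P :=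
      sep_eq_self_iff_mem_true.2 fun F hF => not_subset.1 fun h => hAF ⟨F, hF, h⟩
    rw [heq]
    refine (ncard_le_ncard hA hP.finite_extremePoints).trans ?_
    exact ncard_le_ncard_of_forall_incidence hP.finite_extremePoints hP.finite_facets
      (fun x F => x ∈ F) hd (fun x hx => hP.le_ncard_facets_through hd hfull hx)
      fun F hF => (extremePoints_inter_of_isSimplex hd hfull hF (hs F hF)).2

theorem IsPolytope.hasVertexFacetAssignment_of_isSimple (hd : d ≠ 0) (hP : IsPolytope P)
    (hfull : affineSpan ℝ P = ⊤) (hs : IsSimple P) : HasVertexFacetAssignment P := by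
  have hdeg : ∀ v ∈ P.extremePoints ℝ, {F ∈ facets P | v ∈ F}.ncard = d := by
    intro v hv
    have h := hs {v} (hP.vertices_eq.superset ⟨v, hv, rfl⟩)
    rw [polyDim_eq hfull] at h
    simp only [singleton_subset_iff] at h
    exact_mod_cast h
  refine hP.hasVertexFacetAssignment_of_facets fun A hA => ?_
  by_cases hvA : ∃ v ∈ P.extremePoints ℝ, ∀ F ∈ A, v ∈ F
  · obtain ⟨v, hv, hvA⟩ := hvA
    exact hP.ncard_le_ncard_extremePoints_of_simple_vertex hd hfull hv (hdeg v hv) hA hvA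
  · push Not at hvA
    rw [sep_eq_self_iff_mem_true.2 hvA]
    refine (ncard_le_ncard hA hP.finite_facets).trans ?_
    exact ncard_le_ncard_of_forall_incidence hP.finite_facets hP.finite_extremePoints
      (fun F x => x ∈ F) hd (fun F hF => hP.le_ncard_extremePoints_inter hd hfull hF)
      fun x hx => (hdeg x hx).le

/-- In dimension `0` the polytope is a point, its only facet is empty, and the two are matched. -/
theorem IsPolytope.hasVertexFacetAssignment_of_dim_zero {P : Set (E 0)} (hP : IsPolytope P)
    (hfull : affineSpan ℝ P = ⊤) : HasVertexFacetAssignment P := by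
  refine hP.hasVertexFacetAssignment_of_extremePoints fun A hA => ?_
  obtain rfl | ⟨x, hx⟩ := A.eq_empty_or_nonempty
  · simp
  have hempty : ∅ ∈ {F ∈ facets P | ∃ x ∈ A, x ∉ F} := by
    refine ⟨⟨isExposed_empty, ?_⟩, x, hx, notMem_empty x⟩
    rw [polyDim_eq hfull]
    simp [polyDim]
  exact (ncard_le_one_of_subsingleton A).trans
    ((ncard_pos (hP.finite_facets.subset (sep_subset _ _))).2 ⟨∅, hempty⟩)

end VertexFacet

theorem mainTheorem4 (d : ℕ) (P : Set (VertexFacet.E d))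
    (hP : VertexFacet.IsPolytope P) (hfull : affineSpan ℝ P = ⊤)
    (hsimple : VertexFacet.IsSimple P ∨ VertexFacet.IsSimplicial P) :
    VertexFacet.HasVertexFacetAssignment P := by
  obtain rfl | hd := eq_or_ne d 0
  · exact hP.hasVertexFacetAssignment_of_dim_zero hfull
  · exact hsimple.elim (hP.hasVertexFacetAssignment_of_isSimple hd hfull)
      (hP.hasVertexFacetAssignment_of_isSimplicial hd hfull)
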